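/- Let $I\subseteq\mathbb R$ be an interval. For $n\ge 1$ put $$W_n=\{\lambda\in\mathbb R^n:\ \lambda_1,\dots,\lambda_n\ge 0,\ \lambda_1+\dots+\lambda_n>0\},\qquad W_n^0=\{\lambda\in\mathbb R^n:\ \lambda_1>0,\ \lambda_2,\dots,\lambda_n\ge 0\}.$$ A weighted mean on $I$ is a function $M:\bigcup_{n\ge1} I^n\times W_n\to I$ such that, for all $n$, $x\in I^n$ and $\lambda,\mu\in W_n$: (i) $M(x,t\lambda)=M(x,\lambda)$ for all $t>0$; (ii) $M(x,\lambda+\mu)=M\big((x_1,x_1,\dots,x_n,x_n),(\lambda_1,\mu_1,\dots,\lambda_n,\mu_n)\big)$; (iii) $\min_i x_i\le M(x,\lambda)\le\max_i x_i$; (iv) if $\lambda_j=0$, then $M(x,\lambda)$ does not change when the $j$-th entry and the $j$-th weight are omitted. It is symmetric if $M(x\circ\sigma,\lambda\circ\sigma)=M(x,\lambda)$ for all permutations $\sigma$ of $\{1,\dots,n\}$; Jensen concave if $M\big(\tfrac{x+y}2,\lambda\big)\ge\tfrac12\big(M(x,\lambda)+M(y,\lambda)\big)$ for all $x,y\in I^n$,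 $\lambda\in W_n$; and continuous in the weights if $\lambda\mapsto M(x,\lambda)$ is continuous on $W_n$ for every $n$ and $x\in I^n$. Let $A(x,\lambda)=\frac{\lambda_1x_1+\dots+\lambda_nx_n}{\lambda_1+\dots+\lambda_n}$. For $\lambda\in W_n^0$, a weighted mean $M$ on $I$ satisfies the $(n,\lambda)$-weighted Kedlaya inequality if, for every $x\in I^n$, $$A\big((m_1,\dots,m_n),\lambda\big)\le M\big((a_1,\dots,a_n),\lambda\big),$$ where $m_k=M\big((x_1,\dots,x_k),(\lambda_1,\dots,\lambda_k)\big)$ and $a_k=A\big((x_1,\dots,x_k),(\lambda_1,\dots,\lambda_k)\big)$. Let $WR_n(I)$ be the set of all $\lambda\in W_n^0$ such that every symmetric and Jensen concave weighted mean on $I$ that is continuous in the weights satisfies the $(n,\lambda)$-weighted Kedlaya inequality. **Proposition 4.4.** Let $f:(0,\infty)\to\mathbb R$ be strictly increasing and concave with $f(1)=0$, and let $\mathcal E_f$ be the homogeneous deviation mean on $(0,\infty)$ generated by $E(x,y)=f(x/y)$; that is, for $x\in(0,\infty)^n$ and $\lambda\in W_n$, $\mathcal E_f(x,\lambda)$ is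 the unique $y>0$ with $$\lambda_1f(x_1/y)+\dots+\lambda_nf(x_n/y)=0.$$ Then $\mathcal E_f$ satisfies the $(n,\lambda)$-weighted Kedlaya inequality for all $n\ge1$ and all $\lambda\in WR_n((0,\infty))$. -/

import Mathlib

open Set

namespace WeightedKedlaya

/-- The set of `n`-dimensional real weight vectors: nonnegative entries with positive sum
(it is empty for `n = 0`). -/
def W (n : ℕ) : Set (Fin n → ℝ) :=
  {w | (∀ i, 0 ≤ w i) ∧ 0 < ∑ i, w i}

/-- The real weight vectors whose first entry is positive (empty for `n = 0`). -/
def W0 (n : ℕ) : Set (Fin n → ℝ) :=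
  {w | (∀ i, 0 ≤ w i) ∧ ∃ h : 0 < n, 0 < w ⟨0, h⟩}

/-- The shuffle `(p₁, q₁, p₂, q₂, …, pₙ, qₙ)` of two vectors. -/
def shuffle {n : ℕ} (p q : Fin n → ℝ) : Fin (2 * n) → ℝ := fun k =>
  if (k : ℕ) % 2 = 0 then p ⟨(k : ℕ) / 2, by omega⟩ else q ⟨(k : ℕ) / 2, by omega⟩

/-- The first `k + 1` entries of a vector. -/
def initial {n : ℕ} (x : Fin n → ℝ) (k : Fin n) : Fin ((k : ℕ) + 1) → ℝ :=
  fun i => x (Fin.castLE k.isLt i)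

/-- A family of functions of entries `x` and weights `w`, one for every length `n`. Only the values
at entries in the interval and weights in `W n` matter; all conditions below look at these only. -/
abbrev MeanFamily : Type := ∀ n : ℕ, (Fin n → ℝ) → (Fin n → ℝ) → ℝ

/-- `M` is a weighted mean over `ℝ` on the interval `I`. -/
structure IsWeightedMean (I : Set ℝ) (M : MeanFamily) : Prop where
  mapsTo : ∀ (n : ℕ) (x w : Fin n → ℝ), (∀ i, x i ∈ I) → w ∈ W n → M n x w ∈ I
  /-- Nullhomogeneity in the weights. -/
  nullhomogeneous : ∀ (n : ℕ) (x w : Fin n → ℝ) (t : ℝ), (∀ i, x i ∈ I) → w ∈ W n → 0 < t →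
    M n x w = M n x (t • w)
  /-- Reduction principle. -/
  reduction : ∀ (n : ℕ) (x v w : Fin n → ℝ), (∀ i, x i ∈ I) → v ∈ W n → w ∈ W n →
    M n x (v + w) = M (2 * n) (shuffle x x) (shuffle v w)
  /-- Mean value property. -/
  mean_value : ∀ (n : ℕ) (x w : Fin n → ℝ), (∀ i, x i ∈ I) → w ∈ W n →
    (⨅ i, x i) ≤ M n x w ∧ M n x w ≤ ⨆ i, x i
  /-- Elimination principle: an entry of weight zero can be omitted. -/
  elimination : ∀ (n : ℕ) (x w : Fin (n + 1) → ℝ) (j : Fin (n + 1)), (∀ i, x i ∈ I) →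
    w ∈ W (n + 1) → w j = 0 →
    M (n + 1) x w = M n (fun i => x (j.succAbove i)) (fun i => w (j.succAbove i))

/-- `M` is symmetric: invariant under simultaneous permutations of entries and weights. -/
def IsSymmetric (I : Set ℝ) (M : MeanFamily) : Prop :=
  ∀ (n : ℕ) (x w : Fin n → ℝ) (σ : Equiv.Perm (Fin n)), (∀ i, x i ∈ I) → w ∈ W n →
    M n x w = M n (x ∘ σ) (w ∘ σ)

/-- `M` is Jensen concave in the entries. -/
def IsJensenConcave (I : Set ℝ) (M : MeanFamily) : Prop :=
  ∀ (n : ℕ) (x y w : Fin n → ℝ), (∀ i, x i ∈ I) → (∀ i, y i ∈ I) → w ∈ W n →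
    (M n x w + M n y w) / 2 ≤ M n (fun i => (x i + y i) / 2) w

/-- `M` is continuous in the weights. -/
def IsContinuousInWeights (I : Set ℝ) (M : MeanFamily) : Prop :=
  ∀ (n : ℕ) (x : Fin n → ℝ), (∀ i, x i ∈ I) → ContinuousOn (fun w => M n x w) (W n)

/-- The weighted arithmetic mean. -/
noncomputable def arithMean : MeanFamily := fun _ x w => (∑ i, w i * x i) / ∑ i, w i

/-- The `n` variable `w`-weighted Kedlaya inequality for `M` on `I`, for `w ∈ W0 n`. -/
def KedlayaInequality (I : Set ℝ) (M : MeanFamily) (n : ℕ) (w : Fin n → ℝ) : Prop :=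
  ∀ x : Fin n → ℝ, (∀ i, x i ∈ I) →
    arithMean n (fun k => M ((k : ℕ) + 1) (initial x k) (initial w k)) w ≤
      M n (fun k => arithMean ((k : ℕ) + 1) (initial x k) (initial w k)) w

/-- The weight vectors `w ∈ W0 n` for which every symmetric, Jensen concave weighted mean over `ℝ`
on the interval `I` that is continuous in the weights satisfies the `(n, w)`-weighted Kedlaya
inequality. -/
def WR (I : Set ℝ) (n : ℕ) : Set (Fin n → ℝ) :=
  {w | w ∈ W0 n ∧ ∀ M : MeanFamily, IsWeightedMean I M → IsSymmetric I M → IsJensenConcave I M →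
    IsContinuousInWeights I M → KedlayaInequality I M n w}

/-- `E` is a deviation function on the interval `I`. -/
structure IsDeviation (I : Set ℝ) (E : ℝ → ℝ → ℝ) : Prop where
  diag : ∀ x ∈ I, E x x = 0
  continuousOn : ∀ x ∈ I, ContinuousOn (E x) I
  strictAntiOn : ∀ x ∈ I, StrictAntiOn (E x) I

open Classical in
/-- The weighted deviation mean generated by `E` on `I`: the unique `y ∈ I` with
`w₁ E(x₁, y) + ⋯ + wₙ E(xₙ, y) = 0` (see `deviationMean_spec`; zero if there is none). -/
noncomputable def deviationMean (I : Set ℝ) (E : ℝ → ℝ → ℝ) : MeanFamily := fun _ x w =>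
  if h : ∃ y, y ∈ I ∧ ∑ i, w i * E (x i) y = 0 then h.choose else 0

/-- The homogeneous deviation mean on `(0, ∞)` generated by `E(x, y) = f (x / y)`. -/
noncomputable def homDeviationMean (f : ℝ → ℝ) : MeanFamily :=
  deviationMean (Ioi 0) (fun x y => f (x / y))

/-- For a deviation function on an interval the defining equation of the deviation mean has exactly
one solution, and this solution is the deviation mean. -/
theorem deviationMean_spec {I : Set ℝ} (hI : I.OrdConnected) {E : ℝ → ℝ → ℝ}
    (hE : IsDeviation I E) {n : ℕ} {x w : Fin n → ℝ} (hx : ∀ i, x i ∈ I) (hw : w ∈ W n) (y : ℝ) :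
    (y ∈ I ∧ ∑ i, w i * E (x i) y = 0) ↔ y = deviationMean I E n x w := by
  have hex : ∃ y, y ∈ I ∧ ∑ i, w i * E (x i) y = 0 := by
    have hne : (Finset.univ : Finset (Fin n)).Nonempty := by
      by_contra h
      have := hw.2
      rw [Finset.not_nonempty_iff_eq_empty.1 h] at this
      simp at this
    obtain ⟨a, -, ha⟩ := Finset.exists_min_image Finset.univ x hne
    obtain ⟨b, -, hb⟩ := Finset.exists_max_image Finset.univ x hne
    have hsub : Icc (x a) (x b) ⊆ I := hI.out (hx a) (hx b)
    have hc : ContinuousOn (fun y => ∑ i, w i * E (x i) y) (Icc (x a) (x b)) :=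
      continuousOn_finsetSum _ fun i _ =>
        continuousOn_const.mul ((hE.continuousOn _ (hx i)).mono hsub)
    have h0 : (0 : ℝ) ∈ Icc (∑ i, w i * E (x i) (x b)) (∑ i, w i * E (x i) (x a)) := by
      constructor
      · refine Finset.sum_nonpos fun i _ => mul_nonpos_of_nonneg_of_nonpos (hw.1 i) ?_
        rw [← hE.diag _ (hx i)]
        exact (hE.strictAntiOn _ (hx i)).antitoneOn (hx i) (hx b) (hb i (Finset.mem_univ i))
      · refine Finset.sum_nonneg fun i _ => mul_nonneg (hw.1 i) ?_
        rw [← hE.diag _ (hx i)]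
        exact (hE.strictAntiOn _ (hx i)).antitoneOn (hx a) (hx i) (ha i (Finset.mem_univ i))
    obtain ⟨y, hy, hy0⟩ := intermediate_value_Icc' (ha b (Finset.mem_univ b)) hc h0
    exact ⟨y, hsub hy, hy0⟩
  have hanti : StrictAntiOn (fun y => ∑ i, w i * E (x i) y) I := by
    intro y hy z hz hyz
    obtain ⟨j, -, hj⟩ : ∃ j ∈ Finset.univ, 0 < w j := by
      by_contra! h
      exact absurd hw.2 (not_lt.2 (Finset.sum_nonpos h))
    refine Finset.sum_lt_sum (fun i _ => mul_le_mul_of_nonneg_left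
      ((hE.strictAntiOn _ (hx i)).antitoneOn hy hz hyz.le) (hw.1 i))
      ⟨j, Finset.mem_univ j, mul_lt_mul_of_pos_left (hE.strictAntiOn _ (hx j) hy hz hyz) hj⟩
  have hdef : deviationMean I E n x w = hex.choose := by
    unfold deviationMean
    exact dif_pos hex
  rw [hdef]
  constructor
  · rintro ⟨hy, hy0⟩
    exact hanti.injOn hy hex.choose_spec.1 (hy0.trans hex.choose_spec.2.symm)
  · rintro rfl
    exact hex.choose_spec

/-- A strictly increasing concave function on `(0, ∞)` vanishing at `1` generates a deviation. -/
theorem isDeviation_of_concaveOn {f : ℝ → ℝ} (hf : StrictMonoOn f (Ioi 0))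
    (hc : ConcaveOn ℝ (Ioi 0) f) (h1 : f 1 = 0) :
    IsDeviation (Ioi 0) (fun x y => f (x / y)) where
  diag x hx := by simp only [div_self (ne_of_gt (mem_Ioi.1 hx)), h1]
  continuousOn x hx := by
    refine (hc.continuousOn isOpen_Ioi).comp (t := Ioi 0)
      (continuousOn_const.div continuousOn_id fun y hy => ne_of_gt hy) fun y hy => ?_
    exact div_pos (mem_Ioi.1 hx) (mem_Ioi.1 hy)
  strictAntiOn x hx y hy z hz hyz :=
    hf (div_pos (mem_Ioi.1 hx) (mem_Ioi.1 hz)) (div_pos (mem_Ioi.1 hx) (mem_Ioi.1 hy))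
      (div_lt_div_of_pos_left (mem_Ioi.1 hx) (mem_Ioi.1 hy) hyz)

end WeightedKedlaya

namespace WeightedKedlaya

/-! Membership in `WR` quantifies over all symmetric, Jensen concave weighted means that are
continuous in the weights, so it suffices that the mean generated by `f` is one of them. Everything
is read off from `S(y) = ∑ wᵢ E(xᵢ, y)`, which is strictly decreasing with its zero at the mean.
Symmetry and the algebraic axioms hold because the zero set of `S` is unchanged
(`deviationMean_congr`). Comparing the mean with `y` amounts to finding the sign of `S(y)`
(`le_deviationMean_iff`, `deviationMean_le_iff`); this gives the mean value property, continuity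
and, with concavity of `f`, Jensen concavity. -/

/-- The mean depends on its data only through the predicate fed to `choose`, so neither existence
nor uniqueness of a solution is needed. -/
theorem deviationMean_congr {I : Set ℝ} {E : ℝ → ℝ → ℝ} {m n : ℕ} {x w : Fin m → ℝ}
    {x' w' : Fin n → ℝ}
    (h : ∀ y, ∑ i, w i * E (x i) y = 0 ↔ ∑ i, w' i * E (x' i) y = 0) :
    deviationMean I E m x w = deviationMean I E n x' w' := by
  have hp : (fun y => y ∈ I ∧ ∑ i, w i * E (x i) y = 0) =
      fun y => y ∈ I ∧ ∑ i, w' i * E (x' i) y = 0 := by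
    funext y
    rw [h y]
  unfold deviationMean
  generalize (fun y => y ∈ I ∧ ∑ i, w i * E (x i) y = 0) = p at hp
  subst hp
  rfl

theorem sum_shuffle {n : ℕ} (x v w : Fin n → ℝ) (F : ℝ → ℝ → ℝ) :
    ∑ k, F (shuffle v w k) (shuffle x x k) = ∑ i, (F (v i) (x i) + F (w i) (x i)) := by
  -- The pair `(i, b)` corresponds to the index `b + 2 * i`: quotient by 2 gives the entry, parity
  -- selects `v` or `w`.
  rw [← (finProdFinEquiv.trans (finCongr (mul_comm n 2))).sum_comp, Fintype.sum_prod_type]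
  refine Finset.sum_congr rfl fun i _ => ?_
  rw [Fin.sum_univ_two]
  have h : (1 + 2 * (i : ℕ)) / 2 = i := by omega
  simp [shuffle, h]

section Deviation

variable {I : Set ℝ} {E : ℝ → ℝ → ℝ} {n : ℕ} {x w : Fin n → ℝ}

theorem IsDeviation.strictAntiOn_sum (hE : IsDeviation I E) (hx : ∀ i, x i ∈ I) (hw : w ∈ W n) :
    StrictAntiOn (fun y => ∑ i, w i * E (x i) y) I := by
  intro y hy z hz hyz
  obtain ⟨j, -, hj⟩ : ∃ j ∈ Finset.univ, 0 < w j := by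
    by_contra! h
    exact absurd hw.2 (not_lt.2 (Finset.sum_nonpos h))
  exact Finset.sum_lt_sum (fun i _ => mul_le_mul_of_nonneg_left
    ((hE.strictAntiOn _ (hx i)).antitoneOn hy hz hyz.le) (hw.1 i))
    ⟨j, Finset.mem_univ j, mul_lt_mul_of_pos_left (hE.strictAntiOn _ (hx j) hy hz hyz) hj⟩

variable (hI : I.OrdConnected) (hE : IsDeviation I E) (hx : ∀ i, x i ∈ I) (hw : w ∈ W n)
include hI hE hx hw

theorem deviationMean_mem : deviationMean I E n x w ∈ I :=
  ((deviationMean_spec hI hE hx hw _).2 rfl).1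

theorem sum_deviationMean_eq_zero : ∑ i, w i * E (x i) (deviationMean I E n x w) = 0 :=
  ((deviationMean_spec hI hE hx hw _).2 rfl).2

theorem le_deviationMean_iff {y : ℝ} (hy : y ∈ I) :
    y ≤ deviationMean I E n x w ↔ 0 ≤ ∑ i, w i * E (x i) y := by
  have h := (hE.strictAntiOn_sum hx hw).le_iff_ge (deviationMean_mem hI hE hx hw) hy
  simp only [sum_deviationMean_eq_zero hI hE hx hw] at h
  exact h.symm

theorem deviationMean_le_iff {y : ℝ} (hy : y ∈ I) :
    deviationMean I E n x w ≤ y ↔ ∑ i, w i * E (x i) y ≤ 0 := by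
  have h := (hE.strictAntiOn_sum hx hw).le_iff_ge hy (deviationMean_mem hI hE hx hw)
  simp only [sum_deviationMean_eq_zero hI hE hx hw] at h
  exact h.symm

omit hw in
-- For fixed `a ∈ I`, `S(a)` is linear in the weights, so its strict sign persists nearby, and that
-- sign decides on which side of `a` the mean lies.
theorem continuousOn_deviationMean :
    ContinuousOn (fun w => deviationMean I E n x w) (W n) := by
  intro w hw
  have hm := deviationMean_mem hI hE hx hw
  have hcont : ∀ a, ContinuousWithinAt (fun v : Fin n → ℝ => ∑ i, v i * E (x i) a) (W n) w :=
    fun a => Continuous.continuousWithinAt (by fun_prop)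
  refine tendsto_order.2 ⟨fun a ha => ?_, fun a ha => ?_⟩
  · by_cases haI : a ∈ I
    · have h := lt_iff_lt_of_le_iff_le (deviationMean_le_iff hI hE hx hw haI)
      filter_upwards [(hcont a).eventually (lt_mem_nhds (h.1 ha)), self_mem_nhdsWithin]
        with v hv hvW
      exact (lt_iff_lt_of_le_iff_le (deviationMean_le_iff hI hE hx hvW haI)).2 hv
    -- A point outside the interval `I` cannot separate two means, both of which lie in `I`.
    · filter_upwards [self_mem_nhdsWithin] with v hvW
      by_contra! h
      exact haI (hI.out (deviationMean_mem hI hE hx hvW) hm ⟨h, ha.le⟩)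
  · by_cases haI : a ∈ I
    · have h := lt_iff_lt_of_le_iff_le (le_deviationMean_iff hI hE hx hw haI)
      filter_upwards [(hcont a).eventually (gt_mem_nhds (h.1 ha)), self_mem_nhdsWithin]
        with v hv hvW
      exact (lt_iff_lt_of_le_iff_le (le_deviationMean_iff hI hE hx hvW haI)).2 hv
    · filter_upwards [self_mem_nhdsWithin] with v hvW
      by_contra! h
      exact haI (hI.out hm (deviationMean_mem hI hE hx hvW) ⟨ha.le, h⟩)

theorem deviationMean_mem_Icc :
    (⨅ i, x i) ≤ deviationMean I E n x w ∧ deviationMean I E n x w ≤ ⨆ i, x i := by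
  have : Nonempty (Fin n) := by
    by_contra h
    rw [not_nonempty_iff] at h
    simpa using hw.2
  obtain ⟨a, ha⟩ := exists_eq_ciInf_of_finite (f := x)
  obtain ⟨b, hb⟩ := exists_eq_ciSup_of_finite (f := x)
  have hmin : ∀ i, x a ≤ x i := fun i => ha ▸ ciInf_le (Set.finite_range x).bddBelow i
  have hmax : ∀ i, x i ≤ x b := fun i => hb ▸ le_ciSup (Set.finite_range x).bddAbove i
  rw [← ha, ← hb, le_deviationMean_iff hI hE hx hw (hx a), deviationMean_le_iff hI hE hx hw (hx b)]
  constructor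
  · refine Finset.sum_nonneg fun i _ => mul_nonneg (hw.1 i) ?_
    rw [← hE.diag _ (hx i)]
    exact (hE.strictAntiOn _ (hx i)).antitoneOn (hx a) (hx i) (hmin i)
  · refine Finset.sum_nonpos fun i _ => mul_nonpos_of_nonneg_of_nonpos (hw.1 i) ?_
    rw [← hE.diag _ (hx i)]
    exact (hE.strictAntiOn _ (hx i)).antitoneOn (hx i) (hx b) (hmax i)

end Deviation

theorem isWeightedMean_deviationMean {I : Set ℝ} {E : ℝ → ℝ → ℝ} (hI : I.OrdConnected)
    (hE : IsDeviation I E) : IsWeightedMean I (deviationMean I E) where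
  mapsTo _ _ _ hx hw := deviationMean_mem hI hE hx hw
  nullhomogeneous n x w t _ _ ht := deviationMean_congr fun y => by
    simp only [Pi.smul_apply, smul_eq_mul, mul_assoc, ← Finset.mul_sum, mul_eq_zero, ht.ne',
      false_or]
  reduction n x v w _ _ _ := deviationMean_congr fun y => by
    rw [sum_shuffle x v w fun a b => a * E b y]
    simp only [Pi.add_apply, add_mul]
  mean_value _ _ _ hx hw := deviationMean_mem_Icc hI hE hx hw
  elimination n x w j _ _ hj := deviationMean_congr fun y => by
    rw [Fin.sum_univ_succAbove _ j, hj, zero_mul, zero_add]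

theorem isSymmetric_deviationMean (I : Set ℝ) (E : ℝ → ℝ → ℝ) :
    IsSymmetric I (deviationMean I E) := fun _ x w σ _ _ => deviationMean_congr fun y => by
  rw [← Equiv.sum_comp σ]
  rfl

/-- This is the joint concavity of the perspective `(x, y) ↦ y f(x / y)`, tested at the midpoint of
the two means. -/
theorem isJensenConcave_homDeviationMean {f : ℝ → ℝ} (hf : StrictMonoOn f (Ioi 0))
    (hc : ConcaveOn ℝ (Ioi 0) f) (h1 : f 1 = 0) :
    IsJensenConcave (Ioi 0) (homDeviationMean f) := by
  intro n x x' w hx hx' hw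
  have hE := isDeviation_of_concaveOn hf hc h1
  have hy : 0 < homDeviationMean f n x w := deviationMean_mem ordConnected_Ioi hE hx hw
  have hz : 0 < homDeviationMean f n x' w := deviationMean_mem ordConnected_Ioi hE hx' hw
  have hSy : ∑ i, w i * f (x i / homDeviationMean f n x w) = 0 :=
    sum_deviationMean_eq_zero ordConnected_Ioi hE hx hw
  have hSz : ∑ i, w i * f (x' i / homDeviationMean f n x' w) = 0 :=
    sum_deviationMean_eq_zero ordConnected_Ioi hE hx' hw
  have hm : ∀ i, (x i + x' i) / 2 ∈ Ioi (0 : ℝ) := fun i =>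
    mem_Ioi.2 (half_pos (add_pos (mem_Ioi.1 (hx i)) (mem_Ioi.1 (hx' i))))
  generalize homDeviationMean f n x w = y at *
  generalize homDeviationMean f n x' w = z at *
  refine (le_deviationMean_iff ordConnected_Ioi hE hm hw (half_pos (add_pos hy hz))).2 ?_
  have hyz : 0 < y + z := add_pos hy hz
  -- The coefficients `y / (y + z)` and `z / (y + z)` cancel the denominators: they combine `xᵢ / y`
  -- and `x'ᵢ / z` into `(xᵢ + x'ᵢ) / (y + z)`, the quotient of the two midpoints.
  calc (0 : ℝ)
      = y / (y + z) * ∑ i, w i * f (x i / y) + z / (y + z) * ∑ i, w i * f (x' i / z) := by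
        rw [hSy, hSz, mul_zero, mul_zero, add_zero]
    _ = ∑ i, w i * (y / (y + z) * f (x i / y) + z / (y + z) * f (x' i / z)) := by
        rw [Finset.mul_sum, Finset.mul_sum, ← Finset.sum_add_distrib]
        exact Finset.sum_congr rfl fun i _ => by ring
    _ ≤ _ := by
        refine Finset.sum_le_sum fun i _ => mul_le_mul_of_nonneg_left ?_ (hw.1 i)
        have h := hc.2 (mem_Ioi.2 (div_pos (hx i) hy)) (mem_Ioi.2 (div_pos (hx' i) hz))
          (div_pos hy hyz).le (div_pos hz hyz).le (by rw [← add_div, div_self hyz.ne'])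
        simp only [smul_eq_mul] at h
        convert h using 2
        field_simp

end WeightedKedlaya

theorem proposition4p4 (f : ℝ → ℝ) (hmono : StrictMonoOn f (Set.Ioi 0))
    (hconc : ConcaveOn ℝ (Set.Ioi 0) f) (hone : f 1 = 0)
    (n : ℕ) (w : Fin n → ℝ) (hw : w ∈ WeightedKedlaya.WR (Set.Ioi 0) n) :
    WeightedKedlaya.KedlayaInequality (Set.Ioi 0) (WeightedKedlaya.homDeviationMean f) n w := by
  have hE := WeightedKedlaya.isDeviation_of_concaveOn hmono hconc hone
  exact hw.2 _ (WeightedKedlaya.isWeightedMean_deviationMean Set.ordConnected_Ioi hE)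
    (WeightedKedlaya.isSymmetric_deviationMean _ _)
    (WeightedKedlaya.isJensenConcave_homDeviationMean hmono hconc hone)
    fun _ _ hx => WeightedKedlaya.continuousOn_deviationMean Set.ordConnected_Ioi hE hx
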